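/- Let $L$ be a finite-dimensional Lie algebra over a field $\mathbb F$ of arbitrary characteristic, let $M$ be an abelian ideal of $L$ containing $L'=[L,L]$, and suppose that $L=M\rtimes K$, that is, $K$ is a Lie subalgebra of $L$ with $L=M\oplus K$ as vector spaces. Let $C_L(M)=\{x\in L\mid [x,m]=0 \text{ for all } m\in M\}$, and let $M\rtimes L/C_L(M)$ be the semidirect sum in which $L/C_L(M)$ acts on $M$ through the adjoint action of $L$. Let $U(L)$ be the universal enveloping algebra of $L$ and $\omega(L)$ its augmentation ideal, i.e. the kernel of the algebra homomorphism $U(L)\to\mathbb F$ that maps every element of $L$ to $0$. Let $MU(L)$ and $M\omega(L)$ be the linear spans of the products $mu$ with $m\in M$ and, respectively, $u\in U(L)$ and $u\in\omega(L)$; both are two-sided ideals of $U(L)$. Set $\widetilde I=MU(L)/M\omega(L)$, considered as an abelian Lie algebra, and let the Lie algebra $U(L)$ (with $[a,b]=ab-ba$) act on $\widetilde I$ by $$w\cdot(a+M\omega(L))=(wa-aw)+M\omega(L)\qquad (w\in U(L),\ a\in MU(L)).$$ Let $J=\{w\in U(L)\mid wa-aw\in M\omega(L)\text{ for all }a\in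 MU(L)\}$ be the kernel of this action; it is a Lie ideal of $U(L)$ containing $MU(L)$. Put $\widetilde K=U(L)/J$ and $\widetilde L_M=\widetilde I\rtimes\widetilde K$, the semidirect sum with respect to the induced action. Suppose that $\dim L/C_L(M)\ge\lfloor(\dim M)^2/4\rfloor+1$. Then the following hold. 1. $\widetilde L_M\cong M\rtimes L/C_L(M)$ as Lie algebras. 2. If $C_L(M)=M$, then $U(L)=J\oplus K$ as vector spaces, where $K$ is identified with its image under the canonical map $L\to U(L)$, which is injective on $K$. -/

import Mathlib

namespace EnvelopingInvariant

noncomputable section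

attribute [local instance 100] LieRing.ofAssociativeRing

section Semidirect

variable {F A V : Type*} [Field F] [LieRing A] [LieAlgebra F A]
  [LieRing V] [LieAlgebra F V] [LieRingModule A V] [LieModule F A V]

/-- For a Lie module `V` over `A` which is itself an abelian Lie algebra, the action of the
quotient of `A` by the kernel of the action, `(x + ker) • v = ⁅x, v⁆`. As `V` is abelian, every
endomorphism of `V` is a derivation. -/
def inducedAction (F A V : Type*) [Field F] [LieRing A] [LieAlgebra F A]
    [LieRing V] [LieAlgebra F V] [LieRingModule A V] [LieModule F A V] [IsLieAbelian V] :
    (A ⧸ LieModule.ker F A V) →ₗ⁅F⁆ LieDerivation F V V where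
  toFun q :=
    { toLinearMap := (LieModule.ker F A V).toSubmodule.liftQ
        (LieModule.toEnd F A V : A →ₗ[F] Module.End F V)
        (fun _ hx => hx) q
      leibniz' := fun a b => by simp [LieModule.IsTrivial.trivial] }
  map_add' p q := by ext v; simp
  map_smul' c q := by ext v; simp
  map_lie' {p q} := by
    obtain ⟨x, rfl⟩ := LieSubmodule.Quotient.surjective_mk' _ p
    obtain ⟨y, rfl⟩ := LieSubmodule.Quotient.surjective_mk' _ q
    ext v
    simp only [LieSubmodule.Quotient.mk'_apply, ← LieSubmodule.Quotient.mk_bracket,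
      LieDerivation.lie_apply]
    exact lie_lie x y v

theorem inducedAction_mk [IsLieAbelian V] (x : A) (v : V) :
    inducedAction F A V (LieSubmodule.Quotient.mk x) v = ⁅x, v⁆ := rfl

end Semidirect

open UniversalEnvelopingAlgebra

variable {F L : Type*} [Field F] [LieRing L] [LieAlgebra F L]

/-- The centralizer `C_L(M)`. -/
abbrev centralizer (M : LieIdeal F L) : LieIdeal F L := LieModule.ker F L M

theorem mem_centralizer (M : LieIdeal F L) (x : L) :
    x ∈ centralizer M ↔ ∀ m ∈ M, ⁅x, m⁆ = 0 := by
  simp [centralizer, Subtype.ext_iff]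

/-- The semidirect sum `M ⋊ L / C_L(M)`, for an abelian ideal `M` of `L`; the action is induced by
the adjoint action of `L` on `M`. -/
abbrev idealSemidirect (M : LieIdeal F L) [IsLieAbelian M] : Type _ :=
  LieAlgebra.SemiDirectSum (R := F) M (L ⧸ centralizer M) (inducedAction F L M)

variable (F L) in
/-- The augmentation map of `U(L)`, sending every element of `L` to `0`. -/
def augmentation : UniversalEnvelopingAlgebra F L →ₐ[F] F :=
  UniversalEnvelopingAlgebra.lift F (0 : L →ₗ⁅F⁆ F)

variable (F L) in
/-- The augmentation ideal `ω(L)` of `U(L)`, as a linear subspace. -/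
def augIdeal : Submodule F (UniversalEnvelopingAlgebra F L) :=
  LinearMap.ker (augmentation F L).toLinearMap

/-- The image in `U(L)` of a linear subspace `N` of `L`. -/
def image (N : Submodule F L) : Submodule F (UniversalEnvelopingAlgebra F L) :=
  N.map (ι F : L →ₗ⁅F⁆ UniversalEnvelopingAlgebra F L).toLinearMap

theorem ι_mem_image {M : LieIdeal F L} {m : L} (hm : m ∈ M) : ι F m ∈ image M.toSubmodule :=
  ⟨m, hm, rfl⟩

/-- `M U(L)`: the span of all products `m * u` with `m ∈ M` and `u ∈ U(L)`. -/
def MU (M : LieIdeal F L) : Submodule F (UniversalEnvelopingAlgebra F L) := image M.toSubmodule * ⊤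

/-- `M ω(L)`: the span of all products `m * u` with `m ∈ M` and `u ∈ ω(L)`. -/
def Momega (M : LieIdeal F L) : Submodule F (UniversalEnvelopingAlgebra F L) :=
  image M.toSubmodule * augIdeal F L

/-- An induction principle: a property closed under sums and products that holds on scalars and
on `L` holds on `U(L)`. -/
theorem induction_U {P : UniversalEnvelopingAlgebra F L → Prop}
    (hs : ∀ r, P (algebraMap F _ r)) (hι : ∀ x : L, P (ι F x))
    (hm : ∀ a b, P a → P b → P (a * b)) (ha : ∀ a b, P a → P b → P (a + b))
    (w : UniversalEnvelopingAlgebra F L) : P w := by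
  obtain ⟨t, rfl⟩ : ∃ t, mkAlgHom F L t = w := RingCon.mkₐ_surjective _ w
  induction t using TensorAlgebra.induction with
  | algebraMap r => simpa using hs r
  | ι x => exact hι x
  | mul a b h1 h2 => rw [map_mul]; exact hm _ _ h1 h2
  | add a b h1 h2 => rw [map_add]; exact ha _ _ h1 h2

theorem augmentation_ι (x : L) : augmentation F L (ι F x) = 0 := by
  rw [augmentation, lift_ι_apply]; rfl

theorem mem_augIdeal (w : UniversalEnvelopingAlgebra F L) :
    w ∈ augIdeal F L ↔ augmentation F L w = 0 := Iff.rfl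

/-- `M N` is stable under left multiplication whenever `N` is. -/
theorem mul_left_mem (M : LieIdeal F L) (N : Submodule F (UniversalEnvelopingAlgebra F L))
    (hN : ∀ w, ∀ u ∈ N, w * u ∈ N) (w : UniversalEnvelopingAlgebra F L) :
    ∀ u ∈ image M.toSubmodule * N, w * u ∈ image M.toSubmodule * N := by
  induction w using induction_U with
  | hs r => intro u hu; rw [← Algebra.smul_def]; exact Submodule.smul_mem _ _ hu
  | hm a b h1 h2 => intro u hu; rw [mul_assoc]; exact h1 _ (h2 _ hu)
  | ha a b h1 h2 => intro u hu; rw [add_mul]; exact add_mem (h1 _ hu) (h2 _ hu)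
  | hι x =>
    intro u hu
    induction hu using Submodule.mul_induction_on' with
    | mem_mul_mem m hm n hn =>
      obtain ⟨m, hm, rfl⟩ := hm
      have h : ι F x * (ι F m * n) = ι F ⁅x, m⁆ * n + ι F m * (ι F x * n) := by
        rw [LieHom.map_lie, LieRing.of_associative_ring_bracket]; noncomm_ring
      change ι F x * (ι F m * n) ∈ _
      rw [h]
      exact add_mem (Submodule.mul_mem_mul (ι_mem_image (lie_mem_right F L M x m hm)) hn)
        (Submodule.mul_mem_mul (ι_mem_image hm) (hN _ _ hn))
    | add y _ z _ h1 h2 => rw [mul_add]; exact add_mem h1 h2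

theorem mul_right_mem (M : LieIdeal F L) (N : Submodule F (UniversalEnvelopingAlgebra F L))
    (hN : ∀ w, ∀ u ∈ N, u * w ∈ N) (w : UniversalEnvelopingAlgebra F L) :
    ∀ u ∈ image M.toSubmodule * N, u * w ∈ image M.toSubmodule * N := by
  intro u hu
  induction hu using Submodule.mul_induction_on' with
  | mem_mul_mem m hm n hn => rw [mul_assoc]; exact Submodule.mul_mem_mul hm (hN _ _ hn)
  | add y _ z _ h1 h2 => rw [add_mul]; exact add_mem h1 h2

theorem augIdeal_mul_left (w u : UniversalEnvelopingAlgebra F L) (hu : u ∈ augIdeal F L) :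
    w * u ∈ augIdeal F L := by
  rw [mem_augIdeal] at *; rw [map_mul, hu, mul_zero]

theorem augIdeal_mul_right (w u : UniversalEnvelopingAlgebra F L) (hu : u ∈ augIdeal F L) :
    u * w ∈ augIdeal F L := by
  rw [mem_augIdeal] at *; rw [map_mul, hu, zero_mul]

/-- `M U(L)` as a Lie ideal of `U(L)`. -/
def MULie (M : LieIdeal F L) : LieIdeal F (UniversalEnvelopingAlgebra F L) where
  toSubmodule := MU M
  lie_mem {x u} hu := by
    change ⁅x, u⁆ ∈ MU M
    rw [LieRing.of_associative_ring_bracket]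
    exact sub_mem (mul_left_mem M ⊤ (fun _ _ _ => trivial) x u hu)
      (mul_right_mem M ⊤ (fun _ _ _ => trivial) x u hu)

/-- `M ω(L)`, as a Lie submodule of the `U(L)`-module `M U(L)` (under the adjoint action). -/
def MomegaLie (M : LieIdeal F L) :
    LieSubmodule F (UniversalEnvelopingAlgebra F L) (MULie M) where
  toSubmodule := (Momega M).comap (MULie M).toSubmodule.subtype
  lie_mem {x u} hu := by
    change ⁅x, (u : UniversalEnvelopingAlgebra F L)⁆ ∈ Momega M
    rw [LieRing.of_associative_ring_bracket]
    exact sub_mem (mul_left_mem M _ augIdeal_mul_left x u hu)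
      (mul_right_mem M _ augIdeal_mul_right x u hu)

/-- The vector space `Ĩ = M U(L) / M ω(L)`. -/
def ITilde (M : LieIdeal F L) : Type _ := (MULie M) ⧸ (MomegaLie M)

instance (M : LieIdeal F L) : AddCommGroup (ITilde M) :=
  inferInstanceAs (AddCommGroup ((MULie M) ⧸ (MomegaLie M)))

instance (M : LieIdeal F L) : Module F (ITilde M) :=
  inferInstanceAs (Module F ((MULie M) ⧸ (MomegaLie M)))

/-- The action `β` of `U(L)` on `Ĩ`: `⁅w, a + M ω(L)⁆ = (w * a - a * w) + M ω(L)`. -/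
instance (M : LieIdeal F L) : LieRingModule (UniversalEnvelopingAlgebra F L) (ITilde M) :=
  inferInstanceAs (LieRingModule (UniversalEnvelopingAlgebra F L) ((MULie M) ⧸ (MomegaLie M)))

instance (M : LieIdeal F L) : LieModule F (UniversalEnvelopingAlgebra F L) (ITilde M) :=
  inferInstanceAs (LieModule F (UniversalEnvelopingAlgebra F L) ((MULie M) ⧸ (MomegaLie M)))

/-- `Ĩ` is considered as an abelian Lie algebra. -/
instance (M : LieIdeal F L) : LieRing (ITilde M) where
  bracket _ _ := 0
  add_lie _ _ _ := (add_zero 0).symm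
  lie_add _ _ _ := (add_zero 0).symm
  lie_self _ := rfl
  leibniz_lie _ _ _ := (add_zero 0).symm

instance (M : LieIdeal F L) : LieAlgebra F (ITilde M) where
  lie_smul r _ _ := (smul_zero r).symm

instance (M : LieIdeal F L) : IsLieAbelian (ITilde M) where
  trivial _ _ := rfl

/-- The Lie ideal `J` of `U(L)`: the kernel of the action `β` of `U(L)` on `Ĩ`. -/
abbrev J (M : LieIdeal F L) : LieIdeal F (UniversalEnvelopingAlgebra F L) :=
  LieModule.ker F (UniversalEnvelopingAlgebra F L) (ITilde M)

/-- The underlying linear subspace of `J`. -/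
def JSubspace (M : LieIdeal F L) : Submodule F (UniversalEnvelopingAlgebra F L) :=
  (J M).toSubmodule

theorem mem_J (M : LieIdeal F L) (w : UniversalEnvelopingAlgebra F L) :
    w ∈ J M ↔ ∀ a ∈ MU M, w * a - a * w ∈ Momega M := by
  rw [J, LieModule.mem_ker]
  constructor
  · intro h a ha
    have := h (LieSubmodule.Quotient.mk' (MomegaLie M) ⟨a, ha⟩)
    exact (LieSubmodule.Quotient.mk_eq_zero (N := MomegaLie M) (m := ⁅w, (⟨a, ha⟩ : MULie M)⁆)).1 this
  · intro h q
    obtain ⟨⟨a, ha⟩, rfl⟩ := LieSubmodule.Quotient.surjective_mk' (MomegaLie M) q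
    exact (LieSubmodule.Quotient.mk_eq_zero (N := MomegaLie M) (m := ⁅w, (⟨a, ha⟩ : MULie M)⁆)).2 (h a ha)

theorem MU_le_augIdeal (M : LieIdeal F L) : MU M ≤ augIdeal F L := by
  refine Submodule.mul_le.2 ?_
  rintro _ ⟨m, hm, rfl⟩ u -
  exact augIdeal_mul_right u _ (augmentation_ι m)

/-- `J` contains `M U(L)`, so the action `β` factors through `U(L) / M U(L)`. -/
theorem MU_le_J (M : LieIdeal F L) : MULie M ≤ J M := by
  have key : ∀ v ∈ MU M, ∀ a ∈ MU M, v * a ∈ Momega M := by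
    intro v hv a ha
    induction hv using Submodule.mul_induction_on' with
    | mem_mul_mem m hm n _ =>
      rw [mul_assoc]
      exact Submodule.mul_mem_mul hm (augIdeal_mul_left _ _ (MU_le_augIdeal M ha))
    | add y _ z _ h1 h2 => rw [add_mul]; exact add_mem h1 h2
  intro v hv
  exact (mem_J M v).2 fun a ha => sub_mem (key v hv a ha) (key a ha v hv)

/-- The Lie algebra `L̃_M = Ĩ ⋊_β K̃`, where `K̃ = U(L) / J`. -/
abbrev LTilde (M : LieIdeal F L) : Type _ :=
  LieAlgebra.SemiDirectSum (R := F) (ITilde M) (UniversalEnvelopingAlgebra F L ⧸ J M)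
    (inducedAction F (UniversalEnvelopingAlgebra F L) (ITilde M))

end

end EnvelopingInvariant

namespace EnvelopingInvariant

noncomputable section

open UniversalEnvelopingAlgebra Module

/-! As `L' ⊆ M` and `M` is abelian, `L` acts on `M` by commuting operators, which form a space
isomorphic to `L / C_L(M)`. Schur's bound `finrank_commuting_le` also applies to the unital
commutative algebra they generate, so the dimension hypothesis forces the operators to be that whole
algebra, scalars included (`adjointRep_mem_range`).

The map `m ↦ m + M ω(L)` identifies `M` with `Ĩ`. It is onto since `m u ≡ ε(u) m` modulo `M ω(L)`,
where `ε` is the augmentation. It is injective since the projection to `M` along `K` is a 1-cocycle,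
whose affine representation on `M × F` separates `M` from `M ω(L)`.

Under this identification `w` acts on `Ĩ` as `adjointRep M w - ε(w)` (`lie_toITilde`), hence as some
element of `L`. So `U(L) = J + L`, while `x ∈ L` lies in `J` exactly when it centralizes `M`; both
claims follow. -/

/-! ### Schur's bound for commuting endomorphisms. -/

/-- Commuting endomorphisms of a finite-dimensional space over an algebraically closed field have a
common eigenvector in every nonzero invariant subspace. -/
theorem exists_common_eigenvector {k V : Type*} [Field k] [IsAlgClosed k] [AddCommGroup V]
    [Module k V] [FiniteDimensional k V] (S : Set (End k V))
    (hS : ∀ a ∈ S, ∀ b ∈ S, a * b = b * a) (W : Submodule k V) (hW : W ≠ ⊥)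
    (hSW : ∀ a ∈ S, ∀ w ∈ W, a w ∈ W) :
    ∃ v ∈ W, v ≠ 0 ∧ ∀ a ∈ S, ∃ μ : k, a v = μ • v := by
  -- On a minimal nonzero invariant subspace every `a ∈ S` is a scalar: its eigenspace there is
  -- nonzero and, by commutativity, invariant.
  obtain ⟨X, ⟨hX0, hXW, hX⟩, hmin⟩ := WellFounded.has_min
    (wellFounded_lt (α := Submodule k V))
    {X | X ≠ ⊥ ∧ X ≤ W ∧ ∀ a ∈ S, ∀ w ∈ X, a w ∈ X} ⟨W, hW, le_rfl, hSW⟩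
  obtain ⟨v, hv, hv0⟩ := X.ne_bot_iff.1 hX0
  refine ⟨v, hXW hv, hv0, fun a ha => ?_⟩
  have : Nontrivial X := ⟨⟨⟨v, hv⟩, 0, fun h => hv0 (congrArg Subtype.val h)⟩⟩
  obtain ⟨μ, hμ⟩ := Module.End.exists_eigenvalue (a.restrict (hX a ha))
  obtain ⟨u, hu⟩ := hμ.exists_hasEigenvector
  have hu1 : a u = μ • (u : V) := congrArg Subtype.val hu.apply_eq_smul
  have hu0 : (u : V) ≠ 0 := fun h => hu.2 (Subtype.ext h)
  let Y : Submodule k V := X ⊓ LinearMap.ker (a - μ • (1 : End k V))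
  have hmemY : ∀ w, w ∈ Y ↔ w ∈ X ∧ a w = μ • w := fun w => by
    simp [Y, sub_eq_zero]
  have hY : ¬ Y < X := hmin Y ⟨fun h => hu0 <| by
      have : (u : V) ∈ Y := (hmemY _).2 ⟨u.2, hu1⟩
      rwa [h, Submodule.mem_bot] at this, inf_le_left.trans hXW, fun b hb w hw => by
      obtain ⟨h1, h2⟩ := (hmemY _).1 hw
      refine (hmemY _).2 ⟨hX b hb w h1, ?_⟩
      rw [← Module.End.mul_apply, hS a ha b hb, Module.End.mul_apply, h2, map_smul]⟩
  have hYX : Y = X := by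
    by_contra h
    exact hY (lt_of_le_of_ne inf_le_left h)
  exact ⟨μ, ((hmemY v).1 (hYX ▸ hv)).2⟩

/-- Schur's bound on the dimension of a commuting space of endomorphisms, over an algebraically
closed field. -/
theorem finrank_commuting_le_of_isAlgClosed {k : Type*} [Field k] [IsAlgClosed k] :
    ∀ (n : ℕ) (V : Type*) [AddCommGroup V] [Module k V] [FiniteDimensional k V],
      finrank k V = n → ∀ A : Submodule k (End k V), (∀ a ∈ A, ∀ b ∈ A, a * b = b * a) →
      finrank k A ≤ n ^ 2 / 4 + 1 := by
  intro n
  induction n using Nat.strong_induction_on with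
  | _ n ih =>
  intro V _ _ _ hn A hA
  rcases lt_or_ge n 2 with h2 | h2
  · have h1 : finrank k A ≤ n * n := by
      rw [← hn, ← Module.finrank_linearMap k k V V]
      exact A.finrank_le
    interval_cases n <;> omega
  obtain ⟨v, -, hv0, hv⟩ := exists_common_eigenvector (A : Set (End k V)) hA ⊤
    (fun h => by
      have : finrank k (⊤ : Submodule k V) = 0 := by rw [h, finrank_bot]
      rw [finrank_top] at this; omega) (fun _ _ _ _ => trivial)
  let ℓ : Submodule k V := k ∙ v
  have hℓ : finrank k ℓ = 1 := finrank_span_singleton hv0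
  have hℓA : ∀ a ∈ A, ℓ ≤ ℓ.comap a := by
    intro a ha
    rw [Submodule.span_singleton_le_iff_mem, Submodule.mem_comap]
    obtain ⟨μ, hμ⟩ := hv a ha
    rw [hμ]
    exact Submodule.smul_mem _ _ (Submodule.mem_span_singleton_self v)
  have hann : finrank k ℓ.dualAnnihilator = n - 1 := by
    have := Subspace.finrank_add_finrank_dualAnnihilator_eq ℓ
    omega
  -- A common eigenvector of the transposes, sought in the annihilator of `v`, which is nonzero as
  -- `n ≥ 2`. Its kernel is an invariant hyperplane containing `v`.
  obtain ⟨g, hgv, hg0, hg⟩ := exists_common_eigenvector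
    ((fun a : End k V => a.dualMap) '' (A : Set (End k V)))
    (by
      rintro _ ⟨a, ha, rfl⟩ _ ⟨b, hb, rfl⟩
      exact congrArg LinearMap.dualMap (hA b hb a ha))
    ℓ.dualAnnihilator (fun h => by rw [h, finrank_bot] at hann; omega)
    (by
      rintro _ ⟨a, ha, rfl⟩ f hf
      rw [Submodule.mem_dualAnnihilator] at hf ⊢
      exact fun w hw => hf _ (hℓA a ha hw))
  have hgv : g v = 0 :=
    (Submodule.mem_dualAnnihilator _).1 hgv v (Submodule.mem_span_singleton_self v)
  let H : Submodule k V := LinearMap.ker g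
  have hHA : ∀ a ∈ A, ∀ w ∈ H, a w ∈ H := by
    intro a ha w hw
    obtain ⟨μ, hμ⟩ := hg _ ⟨a, ha, rfl⟩
    have := LinearMap.congr_fun hμ w
    change g (a w) = μ * g w at this
    rw [LinearMap.mem_ker] at hw ⊢
    rw [this, hw, mul_zero]
  have hH : finrank k H = n - 1 := by
    have := Module.Dual.finrank_ker_add_one_of_ne_zero hg0
    change finrank k (LinearMap.ker g) = n - 1
    omega
  have hq : finrank k (V ⧸ ℓ) = n - 1 := by
    have := ℓ.finrank_quotient_add_finrank
    omega
  -- Induction bounds the images in `End (V ⧸ ℓ)` and `End H`; it remains to see that the two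
  -- kernels have total dimension at most `n`.
  let T₁ : A →ₗ[k] End k (V ⧸ ℓ) :=
    { toFun := fun a => ℓ.mapQ ℓ a.1 (hℓA a a.2)
      map_add' := fun a b => by ext; simp
      map_smul' := fun c a => by ext; simp }
  let T₂ : A →ₗ[k] End k H :=
    { toFun := fun a => a.1.restrict (hHA a a.2)
      map_add' := fun a b => by ext; simp
      map_smul' := fun c a => by ext; simp }
  have h₁ := ih (n - 1) (by omega) (V ⧸ ℓ) hq (LinearMap.range T₁) (by
    rintro _ ⟨a, rfl⟩ _ ⟨b, rfl⟩
    ext x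
    have := LinearMap.congr_fun (hA a a.2 b b.2) x
    exact congrArg (Submodule.Quotient.mk (p := ℓ)) this)
  have h₂ := ih (n - 1) (by omega) H hH (LinearMap.range T₂) (by
    rintro _ ⟨a, rfl⟩ _ ⟨b, rfl⟩
    ext x
    exact LinearMap.congr_fun (hA a a.2 b b.2) x)
  have r₁ := T₁.finrank_range_add_finrank_ker
  have r₂ := T₂.finrank_range_add_finrank_ker
  obtain ⟨e, he⟩ : ∃ e, g e = 1 := by
    obtain ⟨x, hx⟩ := DFunLike.ne_iff.1 hg0
    exact ⟨(g x)⁻¹ • x, by rw [map_smul, smul_eq_mul]; exact inv_mul_cancel₀ hx⟩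
  obtain ⟨h, hh⟩ : ∃ h : Module.Dual k V, h v = 1 := by
    exact Module.Projective.exists_dual_eq_one k hv0
  have k₁ : ∀ a : LinearMap.ker T₁, ∀ x, (a : A).1 x ∈ ℓ := fun a x => by
    have := LinearMap.congr_fun (LinearMap.mem_ker.1 a.2) (Submodule.Quotient.mk x)
    exact (Submodule.Quotient.mk_eq_zero ℓ).1 this
  have k₂ : ∀ b : LinearMap.ker T₂, ∀ x, g x = 0 → (b : A).1 x = 0 := fun b x hx =>
    congrArg Subtype.val (LinearMap.congr_fun (LinearMap.mem_ker.1 b.2) ⟨x, hx⟩)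
  -- An element of `ker T₂` kills the hyperplane `H`, so its value at `e ∉ H` determines it.
  let E : LinearMap.ker T₂ →ₗ[k] V :=
    (LinearMap.applyₗ e).comp (A.subtype.comp (LinearMap.ker T₂).subtype)
  have hE : Function.Injective E := by
    refine (injective_iff_map_eq_zero _).2 fun b hb => ?_
    ext x
    have h1 : (b : A).1 (x - g x • e) = 0 := k₂ b _ (by simp [he])
    rw [map_sub, map_smul, show (b : A).1 e = 0 from hb, smul_zero, sub_zero] at h1
    exact h1
  -- An element `a` of `ker T₁` has image in `k v`, so the functional `h ∘ a` determines it. This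
  -- functional kills each `b e` with `b ∈ ker T₂`, because `a b e = b a e ∈ k (b v) = 0`.
  let D : LinearMap.ker T₁ →ₗ[k] (LinearMap.range E).dualAnnihilator :=
    LinearMap.codRestrict _
      ((LinearMap.llcomp k V V k h).comp (A.subtype.comp (LinearMap.ker T₁).subtype)) (by
        intro a
        rw [Submodule.mem_dualAnnihilator]
        rintro _ ⟨b, rfl⟩
        change h ((a : A).1 ((b : A).1 e)) = 0
        have hab := LinearMap.congr_fun (hA a.1.1 a.1.2 b.1.1 b.1.2) e
        change (a : A).1 ((b : A).1 e) = (b : A).1 ((a : A).1 e) at hab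
        obtain ⟨c, hc⟩ := Submodule.mem_span_singleton.1 (k₁ a e)
        rw [hab, ← hc, map_smul, k₂ b v hgv, smul_zero, map_zero])
  have hD : Function.Injective D := by
    refine (injective_iff_map_eq_zero _).2 fun a ha => ?_
    ext x
    obtain ⟨c, hc⟩ := Submodule.mem_span_singleton.1 (k₁ a x)
    have h1 : h ((a : A).1 x) = 0 := LinearMap.congr_fun (congrArg Subtype.val ha) x
    rw [← hc, map_smul, hh, smul_eq_mul, mul_one] at h1
    change (a : A).1 x = 0
    rw [← hc, h1, zero_smul]
  have d₁ := LinearMap.finrank_le_finrank_of_injective hD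
  have d₂ := LinearMap.finrank_range_of_inj hE
  have d₃ := Subspace.finrank_add_finrank_dualAnnihilator_eq (LinearMap.range E)
  have key : 2 * finrank k A ≤ n + 2 * ((n - 1) ^ 2 / 4 + 1) := by omega
  -- The floors depend on the parity of `n`; for odd `n`, halving `key` drops a remaining half.
  obtain ⟨m, rfl | rfl⟩ : ∃ m, n = 2 * m + 2 ∨ n = 2 * m + 3 := ⟨(n - 2) / 2, by omega⟩
  · have e1 : (2 * m + 2 - 1) ^ 2 = 4 * (m * m + m) + 1 := by
      rw [show 2 * m + 2 - 1 = 2 * m + 1 by omega]; ring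
    have e2 : (2 * m + 2) ^ 2 = 4 * (m * m + m) + 4 * m + 4 := by ring
    rw [e1] at key; rw [e2]; omega
  · have e1 : (2 * m + 3 - 1) ^ 2 = 4 * (m * m) + 8 * m + 4 := by
      rw [show 2 * m + 3 - 1 = 2 * m + 2 by omega]; ring
    have e2 : (2 * m + 3) ^ 2 = 4 * (m * m) + 12 * m + 9 := by ring
    rw [e1] at key; rw [e2]; omega

/-- Schur's theorem: a space of commuting endomorphisms of a `d`-dimensional vector space has
dimension at most `⌊d² / 4⌋ + 1`. -/
theorem finrank_commuting_le {F V : Type*} [Field F] [AddCommGroup V] [Module F V]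
    [FiniteDimensional F V] (A : Submodule F (End F V))
    (hA : ∀ a ∈ A, ∀ b ∈ A, a * b = b * a) : finrank F A ≤ finrank F V ^ 2 / 4 + 1 := by
  -- Linear independence and commutation of matrices both survive extension of scalars to the
  -- algebraic closure.
  let k := AlgebraicClosure F
  let n := Fin (finrank F V)
  let b := finBasis F V
  let e := finBasis F A
  let m : Fin (finrank F A) → Matrix n n F := fun i => LinearMap.toMatrixAlgEquiv b (e i).1
  have hm : LinearIndependent F m :=
    ((e.linearIndependent.map' A.subtype (Submodule.ker_subtype A)).map'
      (LinearMap.toMatrixAlgEquiv b).toLinearMap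
      (LinearMap.ker_eq_bot.2 (LinearMap.toMatrixAlgEquiv b).injective))
  let m' : Fin (finrank F A) → Matrix n n k := fun i => (m i).map (algebraMap F k)
  have hm' : LinearIndependent k m' := by
    have h := hm.map' (LinearEquiv.curry F F n n).symm.toLinearMap (LinearEquiv.ker _)
    have h' := linearIndependent_algebraMap_comp_iff (S := k) |>.2 h
    exact h'.map' (LinearEquiv.curry k k n n).toLinearMap (LinearEquiv.ker _)
  let m'' : Fin (finrank F A) → End k (n → k) := fun i => Matrix.toLinAlgEquiv' (m' i)
  have hm'' : LinearIndependent k m'' :=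
    hm'.map' (Matrix.toLinAlgEquiv' (R := k) (n := n)).toLinearMap
      (LinearMap.ker_eq_bot.2 Matrix.toLinAlgEquiv'.injective)
  have hcomm : ∀ i j, m'' i * m'' j = m'' j * m'' i := by
    intro i j
    simp only [m'', m', m]
    rw [← map_mul, ← map_mul, ← Matrix.map_mul, ← Matrix.map_mul, ← map_mul, ← map_mul,
      hA _ (e i).2 _ (e j).2]
  have := finrank_commuting_le_of_isAlgClosed (k := k) (finrank F V) (n → k)
    (by simp [n]) (Submodule.span k (Set.range m'')) (by
      intro x hx y hy
      induction hx, hy using Submodule.span_induction₂ with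
      | mem_mem x y hx hy =>
        obtain ⟨i, rfl⟩ := hx
        obtain ⟨j, rfl⟩ := hy
        exact hcomm i j
      | zero_left => simp
      | zero_right => simp
      | add_left _ _ _ _ _ _ h1 h2 => rw [add_mul, mul_add, h1, h2]
      | add_right _ _ _ _ _ _ h1 h2 => rw [add_mul, mul_add, h1, h2]
      | smul_left _ _ _ _ _ h => rw [smul_mul_assoc, mul_smul_comm, h]
      | smul_right _ _ _ _ _ h => rw [smul_mul_assoc, mul_smul_comm, h])
  rwa [finrank_span_eq_card hm'', Fintype.card_fin] at this

attribute [local instance 100] LieRing.ofAssociativeRing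

variable {F L : Type*} [Field F] [LieRing L] [LieAlgebra F L]

/-! ### The adjoint and affine representations of `U(L)`. -/

/-- The associative representation of `U(L)` on `M` extending the adjoint action of `L`. -/
def adjointRep (M : LieIdeal F L) : UniversalEnvelopingAlgebra F L →ₐ[F] End F M :=
  UniversalEnvelopingAlgebra.lift F (LieModule.toEnd F L M)

theorem adjointRep_ι (M : LieIdeal F L) (x : L) (m : M) : adjointRep M (ι F x) m = ⁅x, m⁆ := by
  rw [adjointRep, lift_ι_apply]; rfl

/-- The affine representation of `L` on `V × F` attached to a `1`-cocycle `p : L → V`. -/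
def affineRep {V : Type*} [AddCommGroup V] [Module F V] [LieRingModule L V] [LieModule F L V]
    (p : L →ₗ[F] V) (hp : ∀ x y, p ⁅x, y⁆ = ⁅x, p y⁆ - ⁅y, p x⁆) : L →ₗ⁅F⁆ End F (V × F) where
  toFun x :=
    { toFun := fun z => (⁅x, z.1⁆ + z.2 • p x, 0)
      map_add' := fun y z => by ext <;> simp [add_smul]; abel
      map_smul' := fun c z => by ext <;> simp [smul_smul] }
  map_add' x y := by
    refine LinearMap.ext fun z => Prod.ext ?_ ?_
    · simp; abel
    · simp
  map_smul' c x := by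
    refine LinearMap.ext fun z => Prod.ext ?_ ?_
    · simp [smul_comm c]
    · simp
  map_lie' {x y} := by
    refine LinearMap.ext fun z => Prod.ext ?_ ?_
    · simp [LieRing.of_associative_ring_bracket, hp, smul_sub]; abel
    · simp [LieRing.of_associative_ring_bracket]

theorem affineRep_apply {V : Type*} [AddCommGroup V] [Module F V] [LieRingModule L V]
    [LieModule F L V] (p : L →ₗ[F] V) (hp : ∀ x y, p ⁅x, y⁆ = ⁅x, p y⁆ - ⁅y, p x⁆) (x : L)
    (z : V × F) : affineRep p hp x z = (⁅x, z.1⁆ + z.2 • p x, 0) := rfl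

theorem lift_affineRep_snd {V : Type*} [AddCommGroup V] [Module F V] [LieRingModule L V]
    [LieModule F L V] (p : L →ₗ[F] V) (hp : ∀ x y, p ⁅x, y⁆ = ⁅x, p y⁆ - ⁅y, p x⁆)
    (w : UniversalEnvelopingAlgebra F L) :
    ∀ z, (UniversalEnvelopingAlgebra.lift F (affineRep p hp) w z).2 = augmentation F L w * z.2 := by
  induction w using induction_U with
  | hs r => intro z; simp [Algebra.algebraMap_eq_smul_one]
  | hι x => intro z; rw [lift_ι_apply, affineRep_apply, augmentation_ι, zero_mul]
  | hm a b h1 h2 => intro z; rw [map_mul, Module.End.mul_apply, h1, h2, map_mul, mul_assoc]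
  | ha a b h1 h2 =>
    intro z; rw [map_add, LinearMap.add_apply, Prod.snd_add, h1, h2, map_add, add_mul]

/-- A cocycle that restricts to the identity on `M` exists when `L = M ⋊ K`. -/
theorem exists_cocycle (M : LieIdeal F L) [IsLieAbelian M]
    (hM : ⁅(⊤ : LieIdeal F L), (⊤ : LieIdeal F L)⁆ ≤ M)
    (K : LieSubalgebra F L) (hK : IsCompl M.toSubmodule K.toSubmodule) :
    ∃ p : L →ₗ[F] M, (∀ x y, p ⁅x, y⁆ = ⁅x, p y⁆ - ⁅y, p x⁆) ∧ ∀ m : M, p m = m := by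
  have hid : ∀ m : M, M.toSubmodule.projectionOnto K.toSubmodule hK m = m := fun m =>
    Submodule.projectionOnto_apply_left hK m
  refine ⟨M.toSubmodule.projectionOnto K.toSubmodule hK, fun x y => ?_, hid⟩
  set p := M.toSubmodule.projectionOnto K.toSubmodule hK
  have hq : ∀ x, x - (p x : L) ∈ K := fun x => by
    have : p (x - (p x : L)) = 0 := by rw [map_sub, hid, sub_self]
    exact (Submodule.projectionOnto_apply_eq_zero_iff hK).1 this
  have hmem : ∀ x y : L, ⁅x, y⁆ ∈ M := fun x y =>
    hM (LieSubmodule.lie_mem_lie (LieSubmodule.mem_top x) (LieSubmodule.mem_top y))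
  -- `K` is abelian, since `[K, K] ⊆ K ∩ L' ⊆ K ∩ M = 0`; expanding this bracket gives the cocycle
  -- identity.
  have h0 : ⁅x - (p x : L), y - (p y : L)⁆ = 0 :=
    (Submodule.disjoint_def.1 hK.disjoint) _ (hmem _ _) (K.lie_mem (hq x) (hq y))
  have hab : ⁅(p x : L), (p y : L)⁆ = 0 :=
    congrArg Subtype.val (LieModule.IsTrivial.trivial (L := M) (M := M) (p x) (p y))
  have h1 : p ⁅x, y⁆ = ⟨⁅x, y⁆, hmem x y⟩ := hid ⟨_, hmem x y⟩
  rw [h1]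
  refine Subtype.ext ?_
  change ⁅x, y⁆ = ⁅x, (p y : L)⁆ - ⁅y, (p x : L)⁆
  rw [sub_lie, lie_sub, lie_sub, hab, sub_zero] at h0
  rw [← lie_skew y (p x : L), sub_neg_eq_add]
  rw [sub_sub, sub_eq_zero] at h0
  exact h0

/-! ### Computation modulo `M ω(L)`. -/

theorem sub_augmentation_mem (w : UniversalEnvelopingAlgebra F L) :
    w - algebraMap F _ (augmentation F L w) ∈ augIdeal F L := by
  rw [mem_augIdeal, map_sub, AlgHom.commutes]; exact sub_self _

/-- In the affine representation `ω(L)` maps into `M × 0`, which `M` kills because it is abelian. So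
`M ω(L)` kills `(0, 1)`, whereas `m` sends it to `(m, 0)`. -/
theorem eq_zero_of_ι_mem_Momega (M : LieIdeal F L) [IsLieAbelian M]
    (hM : ⁅(⊤ : LieIdeal F L), (⊤ : LieIdeal F L)⁆ ≤ M)
    (K : LieSubalgebra F L) (hK : IsCompl M.toSubmodule K.toSubmodule) (m : M)
    (hm : ι F (m : L) ∈ Momega M) : m = 0 := by
  obtain ⟨p, hp, hid⟩ := exists_cocycle M hM K hK
  set ρ := UniversalEnvelopingAlgebra.lift F (affineRep p hp) with hρ
  have hι : ∀ (m : M) z, ρ (ι F (m : L)) z = (z.2 • m, 0) := fun m z => by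
    rw [hρ, lift_ι_apply, affineRep_apply, hid]
    have : ⁅(m : L), z.1⁆ = 0 := LieModule.IsTrivial.trivial (L := M) (M := M) m z.1
    rw [this, zero_add]
  have key : ∀ a ∈ Momega M, ρ a (0, 1) = 0 := by
    intro a ha
    induction ha using Submodule.mul_induction_on' with
    | mem_mul_mem a ha n hn =>
      obtain ⟨a, ha, rfl⟩ := ha
      rw [map_mul, Module.End.mul_apply]
      refine (hι ⟨a, ha⟩ _).trans ?_
      rw [lift_affineRep_snd, (mem_augIdeal n).1 hn, zero_mul, zero_smul]; rfl
    | add y _ z _ h1 h2 => rw [map_add, LinearMap.add_apply, h1, h2, add_zero]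
  have := key _ hm
  rw [hι, one_smul] at this
  exact congrArg Prod.fst this

/-- For `x ∈ L` this is `x m = [x, m] + m x` with `m x ∈ M ω(L)`; products follow as `M ω(L)` is a
left ideal. -/
theorem mul_ι_sub_mem (M : LieIdeal F L) (w : UniversalEnvelopingAlgebra F L) :
    ∀ m : M, w * ι F (m : L) - ι F (adjointRep M w m : L) ∈ Momega M := by
  induction w using induction_U with
  | hs r =>
    intro m
    have : r • ι F (m : L) - ι F (r • (m : L)) = 0 := by rw [map_smul, sub_self]
    rw [AlgHom.commutes, ← Algebra.smul_def]
    exact this ▸ zero_mem (Momega M)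
  | hι x =>
    intro m
    rw [adjointRep_ι]
    have : ι F x * ι F (m : L) - ι F ⁅x, (m : L)⁆ = ι F (m : L) * ι F x := by
      rw [LieHom.map_lie, LieRing.of_associative_ring_bracket, sub_sub_cancel]
    change ι F x * ι F (m : L) - ι F ⁅x, (m : L)⁆ ∈ _
    rw [this]
    exact Submodule.mul_mem_mul (ι_mem_image m.2) (augmentation_ι x)
  | hm a b h1 h2 =>
    intro m
    have := add_mem (mul_left_mem M _ augIdeal_mul_left a _ (h2 m)) (h1 (adjointRep M b m))
    rw [map_mul, Module.End.mul_apply]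
    rwa [mul_sub, ← mul_assoc, sub_add_sub_cancel] at this
  | ha a b h1 h2 =>
    intro m
    have := add_mem (h1 m) (h2 m)
    rw [map_add, LinearMap.add_apply, add_mul, Submodule.coe_add, map_add]
    rwa [add_sub_add_comm]

/-- Modulo `M ω(L)`, left multiplication by `w` is the adjoint action and right multiplication is
the scalar `ε(w)`. -/
theorem commutator_ι_sub_mem (M : LieIdeal F L) (w : UniversalEnvelopingAlgebra F L) (m : M) :
    w * ι F (m : L) - ι F (m : L) * w -
      ι F ((adjointRep M w m - augmentation F L w • m : M) : L) ∈ Momega M := by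
  have h := Submodule.mul_mem_mul (ι_mem_image m.2) (sub_augmentation_mem w)
  have := sub_mem (mul_ι_sub_mem M w m) h
  rw [mul_sub, ← Algebra.commutes, ← Algebra.smul_def] at this
  have h2 : ι F ((adjointRep M w m - augmentation F L w • m : M) : L) =
      ι F (adjointRep M w m : L) - augmentation F L w • ι F (m : L) := by
    change ι F ((adjointRep M w m : L) - augmentation F L w • (m : L)) = _
    rw [map_sub, map_smul]
  rw [h2]
  convert this using 1
  abel

theorem ι_mem_MU {M : LieIdeal F L} {m : L} (hm : m ∈ M) : ι F m ∈ MU M := by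
  have := Submodule.mul_mem_mul (ι_mem_image hm)
    (Submodule.mem_top (x := (1 : UniversalEnvelopingAlgebra F L)) (R := F))
  rwa [mul_one] at this

theorem exists_sub_ι_mem_Momega (M : LieIdeal F L) (a : UniversalEnvelopingAlgebra F L)
    (ha : a ∈ MU M) : ∃ m : M, a - ι F (m : L) ∈ Momega M := by
  induction ha using Submodule.mul_induction_on' with
  | mem_mul_mem a ha u hu =>
    obtain ⟨a, ha, rfl⟩ := ha
    refine ⟨augmentation F L u • ⟨a, ha⟩, ?_⟩
    have h := Submodule.mul_mem_mul (ι_mem_image ha) (sub_augmentation_mem u)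
    rw [mul_sub, ← Algebra.commutes, ← Algebra.smul_def, ← map_smul] at h
    exact h
  | add y _ z _ h1 h2 =>
    obtain ⟨m, hm⟩ := h1
    obtain ⟨n, hn⟩ := h2
    refine ⟨m + n, ?_⟩
    have := add_mem hm hn
    rw [Submodule.coe_add, map_add]
    rwa [add_sub_add_comm]

/-! ### The identification of `Ĩ` with `M`. -/

/-- The map `M → Ĩ`, `m ↦ m + M ω(L)`. -/
def toITilde (M : LieIdeal F L) : M →ₗ[F] ITilde M :=
  (LieSubmodule.Quotient.mk' (MomegaLie M)).toLinearMap.comp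
    (LinearMap.codRestrict (MULie M).toSubmodule
      ((ι F : L →ₗ⁅F⁆ UniversalEnvelopingAlgebra F L).toLinearMap.comp M.toSubmodule.subtype)
      fun m => ι_mem_MU m.2)

theorem toITilde_surjective (M : LieIdeal F L) : Function.Surjective (toITilde M) := by
  intro q
  obtain ⟨⟨a, ha⟩, rfl⟩ := LieSubmodule.Quotient.surjective_mk' (MomegaLie M) q
  obtain ⟨m, hm⟩ := exists_sub_ι_mem_Momega M a ha
  refine ⟨m, Eq.symm (sub_eq_zero.1 ?_)⟩
  exact (LieSubmodule.Quotient.mk_eq_zero (N := MomegaLie M)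
    (m := ⟨a, ha⟩ - ⟨ι F (m : L), ι_mem_MU m.2⟩)).2 hm

theorem toITilde_injective (M : LieIdeal F L) [IsLieAbelian M]
    (hM : ⁅(⊤ : LieIdeal F L), (⊤ : LieIdeal F L)⁆ ≤ M)
    (K : LieSubalgebra F L) (hK : IsCompl M.toSubmodule K.toSubmodule) :
    Function.Injective (toITilde M) :=
  (injective_iff_map_eq_zero _).2 fun m hm => eq_zero_of_ι_mem_Momega M hM K hK m
    ((LieSubmodule.Quotient.mk_eq_zero (N := MomegaLie M)
      (m := ⟨ι F (m : L), ι_mem_MU m.2⟩)).1 hm)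

theorem lie_toITilde (M : LieIdeal F L) (w : UniversalEnvelopingAlgebra F L) (m : M) :
    ⁅w, toITilde M m⁆ = toITilde M (adjointRep M w m - augmentation F L w • m) := by
  refine sub_eq_zero.1 ((LieSubmodule.Quotient.mk_eq_zero (N := MomegaLie M)
    (m := ⁅w, (⟨ι F (m : L), ι_mem_MU m.2⟩ : MULie M)⁆ -
      ⟨ι F ((adjointRep M w m - augmentation F L w • m : M) : L), ι_mem_MU (Subtype.mem _)⟩)).2 ?_)
  exact commutator_ι_sub_mem M w m

theorem lie_ι_toITilde (M : LieIdeal F L) (x : L) (m : M) :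
    ⁅ι F x, toITilde M m⁆ = toITilde M ⁅x, m⁆ := by
  rw [lie_toITilde, adjointRep_ι, augmentation_ι, zero_smul, sub_zero]

/-! ### The kernel `J` and the quotient `U(L) / J`. -/

theorem ι_mem_J_iff (M : LieIdeal F L) (hinj : Function.Injective (toITilde M)) (x : L) :
    ι F x ∈ J M ↔ x ∈ centralizer M := by
  rw [J, LieModule.mem_ker, LieModule.mem_ker, (toITilde_surjective M).forall]
  refine forall_congr' fun m => ?_
  rw [lie_ι_toITilde, map_eq_zero_iff _ hinj]

/-- If `L / C_L(M)` has the maximal possible dimension, then the operators on `M` induced by `L`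
form a unital associative algebra, so that `U(L)` acts on `M` through them. -/
theorem adjointRep_mem_range [FiniteDimensional F L] (M : LieIdeal F L) [IsLieAbelian M]
    (hM : ⁅(⊤ : LieIdeal F L), (⊤ : LieIdeal F L)⁆ ≤ M)
    (hdim : finrank F M ^ 2 / 4 + 1 ≤ finrank F (L ⧸ centralizer M))
    (w : UniversalEnvelopingAlgebra F L) :
    adjointRep M w ∈ LinearMap.range (LieModule.toEnd F L M : L →ₗ[F] End F M) := by
  set A := LinearMap.range (LieModule.toEnd F L M : L →ₗ[F] End F M) with hA
  have hcomm : ∀ a ∈ (A : Set (End F M)), ∀ b ∈ (A : Set (End F M)), a * b = b * a := by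
    rintro _ ⟨x, rfl⟩ _ ⟨y, rfl⟩
    refine sub_eq_zero.1 ?_
    have h : ⁅x, y⁆ ∈ M :=
      hM (LieSubmodule.lie_mem_lie (LieSubmodule.mem_top x) (LieSubmodule.mem_top y))
    have h1 : LieModule.toEnd F L M ⁅x, y⁆ = 0 := by
      ext1 m
      exact LieModule.IsTrivial.trivial (L := M) (M := M) ⟨_, h⟩ m
    rwa [LieHom.map_lie, LieRing.of_associative_ring_bracket] at h1
  have hfr : finrank F (L ⧸ centralizer M) = finrank F A :=
    (LieModule.toEnd F L M : L →ₗ[F] End F M).quotKerEquivRange.finrank_eq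
  have := Algebra.isMulCommutative_adjoin F hcomm
  have hB := finrank_commuting_le (Subalgebra.toSubmodule (Algebra.adjoin F (A : Set (End F M))))
    fun a ha b hb => congrArg Subtype.val
      (mul_comm' (⟨a, ha⟩ : Algebra.adjoin F (A : Set (End F M))) ⟨b, hb⟩)
  have hle : A ≤ Subalgebra.toSubmodule (Algebra.adjoin F (A : Set (End F M))) :=
    fun a ha => Algebra.subset_adjoin ha
  -- Schur's bound for the generated algebra is at most the dimension of its subspace `A`, by
  -- `hdim`.
  have heq := Submodule.eq_of_le_of_finrank_le hle (by omega)
  rw [heq, Subalgebra.mem_toSubmodule]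
  induction w using induction_U with
  | hs r => rw [AlgHom.commutes]; exact Subalgebra.algebraMap_mem _ r
  | hι x => exact Algebra.subset_adjoin ⟨x, by rw [adjointRep, lift_ι_apply]; rfl⟩
  | hm a b h1 h2 => rw [map_mul]; exact mul_mem h1 h2
  | ha a b h1 h2 => rw [map_add]; exact add_mem h1 h2

theorem exists_sub_ι_mem_J [FiniteDimensional F L] (M : LieIdeal F L) [IsLieAbelian M]
    (hM : ⁅(⊤ : LieIdeal F L), (⊤ : LieIdeal F L)⁆ ≤ M)
    (hdim : finrank F M ^ 2 / 4 + 1 ≤ finrank F (L ⧸ centralizer M))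
    (w : UniversalEnvelopingAlgebra F L) : ∃ x : L, w - ι F x ∈ J M := by
  -- The shift by `ε(w)` matches the scalar term in `lie_toITilde`, so `x` and `w` act alike on `Ĩ`.
  obtain ⟨x, hx⟩ := adjointRep_mem_range M hM hdim (w - algebraMap F _ (augmentation F L w))
  refine ⟨x, ?_⟩
  rw [J, LieModule.mem_ker, (toITilde_surjective M).forall]
  intro m
  have h := LinearMap.congr_fun hx m
  rw [map_sub, AlgHom.commutes] at h
  rw [sub_lie, lie_ι_toITilde, lie_toITilde]
  exact sub_eq_zero.2 (congrArg _ h.symm)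

/-- The Lie algebra homomorphism `L / C_L(M) → U(L) / J` induced by `L → U(L)`. -/
def quotientMap (M : LieIdeal F L) (h : ∀ x, x ∈ centralizer M → ι F x ∈ J M) :
    (L ⧸ centralizer M) →ₗ⁅F⁆ (UniversalEnvelopingAlgebra F L ⧸ J M) where
  __ := (centralizer M).toSubmodule.mapQ (J M).toSubmodule
    (ι F : L →ₗ⁅F⁆ UniversalEnvelopingAlgebra F L).toLinearMap h
  map_lie' {p q} := by
    obtain ⟨x, rfl⟩ := LieSubmodule.Quotient.surjective_mk' _ p
    obtain ⟨y, rfl⟩ := LieSubmodule.Quotient.surjective_mk' _ q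
    change LieSubmodule.Quotient.mk (N := J M) (ι F ⁅x, y⁆) = _
    rw [LieHom.map_lie]
    rfl

theorem quotientMap_mk (M : LieIdeal F L) (h : ∀ x, x ∈ centralizer M → ι F x ∈ J M) (x : L) :
    quotientMap M h (LieSubmodule.Quotient.mk x) = LieSubmodule.Quotient.mk (ι F x) := rfl

theorem quotientMap_bijective (M : LieIdeal F L) (hJ : ∀ x, ι F x ∈ J M ↔ x ∈ centralizer M)
    (hsurj : ∀ w, ∃ x : L, w - ι F x ∈ J M) :
    Function.Bijective (quotientMap M fun x => (hJ x).2) := by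
  constructor
  · refine (injective_iff_map_eq_zero _).2 fun q hq => ?_
    obtain ⟨x, rfl⟩ := LieSubmodule.Quotient.surjective_mk' _ q
    exact (LieSubmodule.Quotient.mk_eq_zero (N := centralizer M)).2
      ((hJ x).1 ((LieSubmodule.Quotient.mk_eq_zero (N := J M)).1 hq))
  · intro q
    obtain ⟨w, rfl⟩ := LieSubmodule.Quotient.surjective_mk' _ q
    obtain ⟨x, hx⟩ := hsurj w
    refine ⟨LieSubmodule.Quotient.mk x, Eq.symm (sub_eq_zero.1 ?_)⟩
    exact (LieSubmodule.Quotient.mk_eq_zero (N := J M) (m := w - ι F x)).2 hx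

/-! ### The isomorphism of semidirect sums and the complement of `J`. -/

/-- The homomorphism `M ⋊ L / C_L(M) → L̃_M`. -/
def semidirectMap (M : LieIdeal F L) [IsLieAbelian M]
    (h : ∀ x, x ∈ centralizer M → ι F x ∈ J M) : idealSemidirect M →ₗ⁅F⁆ LTilde M where
  toFun z := ⟨toITilde M z.left, quotientMap M h z.right⟩
  map_add' y z := by
    refine LieAlgebra.SemiDirectSum.ext ?_ ?_ <;> exact map_add _ _ _
  map_smul' c z := by
    refine LieAlgebra.SemiDirectSum.ext ?_ ?_ <;> exact map_smul _ _ _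
  map_lie' {y z} := by
    have key : ∀ q m, toITilde M (inducedAction F L M q m) =
        inducedAction F (UniversalEnvelopingAlgebra F L) (ITilde M)
          (quotientMap M h q) (toITilde M m) := by
      intro q m
      obtain ⟨x, rfl⟩ := LieSubmodule.Quotient.surjective_mk' _ q
      rw [LieSubmodule.Quotient.mk'_apply, quotientMap_mk, inducedAction_mk, inducedAction_mk,
        lie_ι_toITilde]
    refine LieAlgebra.SemiDirectSum.ext ?_ (LieHom.map_lie _ _ _)
    simp only [LieAlgebra.SemiDirectSum.lie_eq_mk, map_sub, map_add, key,
      LieModule.IsTrivial.trivial, map_zero]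

theorem semidirectMap_bijective (M : LieIdeal F L) [IsLieAbelian M]
    (hinj : Function.Injective (toITilde M)) (hJ : ∀ x, ι F x ∈ J M ↔ x ∈ centralizer M)
    (hsurj : ∀ w, ∃ x : L, w - ι F x ∈ J M) :
    Function.Bijective (semidirectMap M fun x => (hJ x).2) := by
  obtain ⟨h1, h2⟩ := quotientMap_bijective M hJ hsurj
  constructor
  · intro y z hyz
    exact LieAlgebra.SemiDirectSum.ext
      (hinj (congrArg LieAlgebra.SemiDirectSum.left hyz))
      (h1 (congrArg LieAlgebra.SemiDirectSum.right hyz))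
  · intro z
    obtain ⟨m, hm⟩ := toITilde_surjective M z.left
    obtain ⟨q, hq⟩ := h2 z.right
    exact ⟨⟨m, q⟩, LieAlgebra.SemiDirectSum.ext hm hq⟩

/-- If `C_L(M) = M`, every complement of `M` in `L` maps injectively to a complement of `J`. -/
theorem isCompl_J_image (M : LieIdeal F L) (K : LieSubalgebra F L)
    (hK : IsCompl M.toSubmodule K.toSubmodule) (hJ : ∀ x, ι F x ∈ J M ↔ x ∈ centralizer M)
    (hsurj : ∀ w, ∃ x : L, w - ι F x ∈ J M) (hC : centralizer M = M) :
    Set.InjOn (ι F : L → UniversalEnvelopingAlgebra F L) K ∧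
      IsCompl (JSubspace M) (image K.toSubmodule) := by
  have hKJ : ∀ x ∈ K, ι F x ∈ J M → x = 0 := fun x hx h =>
    Submodule.disjoint_def.1 hK.disjoint x (hC ▸ (hJ x).1 h) hx
  refine ⟨fun x hx y hy hxy => sub_eq_zero.1 (hKJ _ (K.sub_mem hx hy) ?_), ?_⟩
  · rw [map_sub, hxy, sub_self]; exact zero_mem _
  · constructor
    · rw [Submodule.disjoint_def]
      rintro _ hx ⟨x, hxK, rfl⟩
      exact (congrArg (ι F) (hKJ x hxK hx)).trans (map_zero _)
    · rw [codisjoint_iff, eq_top_iff]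
      rintro w -
      obtain ⟨x, hx⟩ := hsurj w
      obtain ⟨m, hm, y, hy, rfl⟩ := Submodule.mem_sup.1
        (hK.sup_eq_top ▸ Submodule.mem_top : x ∈ M.toSubmodule ⊔ K.toSubmodule)
      have hmJ : ι F m ∈ J M := (hJ m).2 (hC.symm ▸ hm)
      refine Submodule.mem_sup.2 ⟨w - ι F y, ?_, ι F y, ⟨y, hy, rfl⟩, sub_add_cancel _ _⟩
      have := add_mem hx hmJ
      rw [map_add] at this
      change w - ι F y ∈ J M
      convert this using 1
      abel

end

end EnvelopingInvariant

theorem mainTheorem8 {F L : Type*} [Field F] [LieRing L] [LieAlgebra F L]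
    [FiniteDimensional F L] (M : LieIdeal F L) [IsLieAbelian M]
    (hM : ⁅(⊤ : LieIdeal F L), (⊤ : LieIdeal F L)⁆ ≤ M)
    (K : LieSubalgebra F L) (hK : IsCompl M.toSubmodule K.toSubmodule)
    (hdim : Module.finrank F M ^ 2 / 4 + 1 ≤
      Module.finrank F (L ⧸ EnvelopingInvariant.centralizer M)) :
    Nonempty (EnvelopingInvariant.LTilde M ≃ₗ⁅F⁆ EnvelopingInvariant.idealSemidirect M) ∧
    (EnvelopingInvariant.centralizer M = M →
      Set.InjOn (UniversalEnvelopingAlgebra.ι F : L → UniversalEnvelopingAlgebra F L) K ∧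
      IsCompl (EnvelopingInvariant.JSubspace M) (EnvelopingInvariant.image K.toSubmodule)) := by
  have hinj := EnvelopingInvariant.toITilde_injective M hM K hK
  have hJ := EnvelopingInvariant.ι_mem_J_iff M hinj
  have hsurj := EnvelopingInvariant.exists_sub_ι_mem_J M hM hdim
  exact ⟨⟨(LieEquiv.ofBijective _
    (EnvelopingInvariant.semidirectMap_bijective M hinj hJ hsurj)).symm⟩,
    EnvelopingInvariant.isCompl_J_image M K hK hJ hsurj⟩
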